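/- \textbf{Setting.} Let $\mathcal S$ be a finite set of states and, for each $s\in\mathcal S$, let $\mathcal A(s)$ be a finite nonempty set of actions; let $\mathcal X=\{(s,a):s\in\mathcal S,\ a\in\mathcal A(s)\}$ be the set of pairs. A Markov decision process (MDP) $M$ on $\mathcal X$ consists of a transition kernel $p(\cdot\mid x)$ on $\mathcal S$ and a reward distribution $q(x)$ on $\mathbb R$ with finite mean $r(x)$, for each $x\in\mathcal X$. For a stationary deterministic policy $\pi$ (an element of $\prod_s\mathcal A(s)$), let $g^\pi(s)=\lim_{T}\frac1T\mathbb E^\pi_s[\sum_{t=1}^T R_t]$ be its gain and let its bias $h^\pi(s)$ be the Cesàro limit of $\mathbb E^\pi_s[\sum_{t=1}^T(R_t-g^\pi(S_t))]$ as $T\to\infty$. Put $g^*(s)=\max_\pi g^\pi(s)$, let $\Pi^*(M)=\{\pi:g^\pi=g^*\}$ be the set of gain-optimal policies, let $h^*(s)=\max_{\pi\in\Pi^*(M)}h^\pi(s)$, and define the gaps $$\Delta^*((s,a);M)=h^*(s)+g^*(s)-r(s,a)-\sum_{s'}p(s'\mid s,a)\,h^*(s').$$ Let $\mathcal X^*(M)$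 be the set of optimal pairs, i.e. the pairs that are recurrent under some $\pi\in\Pi^*(M)$, and let $\mathcal X_-(M)=\{x:\Delta^*(x;M)>0\}$ be the set of suboptimal pairs. $M$ is communicating if every state can be reached with positive probability from every other one by suitable actions. Write $M^\dagger\gg M$ if, for all $x\in\mathcal X$, $p(\cdot\mid x)\ll p^\dagger(\cdot\mid x)$ and $q(x)\ll q^\dagger(x)$. For a set $\mathcal M$ of MDPs on $\mathcal X$ and $M\in\mathcal M$, the alternative set of $M$ is $$\mathrm{Alt}(M)=\{M^\dagger\in\mathcal M: M^\dagger\gg M\text{ and }\Pi^*(M^\dagger)\cap\Pi^*(M)=\emptyset\}.$$ A learner $\Lambda$ chooses each action at random as a measurable function of the past states, actions and rewards and of the current state. $\Pr^{M^\dagger,\Lambda}_{s_0}$ denotes the law of its interaction $(S_t,A_t,R_t)_{t\ge1}$ with $M^\dagger$ started at $S_1=s_0$, and $N_{T+1}(x)=\sum_{t=1}^T\mathbf 1\{(S_t,A_t)=x\}$. \textbf{Lemma.} Let $M\in\mathcal M$ be communicating, let $M^\dagger\in\mathrm{Alt}(M)$, and let $\mathcal X_c=\{x\in\mathcal X^*(M^\dagger):\Delta^*(x;M)>0\}$.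 There exist constants $\varepsilon,D>0$ and $T_0\in\mathbb N$ such that, for every learner $\Lambda$, every initial state $s_0\in\mathcal S$, every integer $T\ge T_0$ and every $u\ge 0$, $$\Pr^{M^\dagger,\Lambda}_{s_0}\Big(\sum_{x\in\mathcal X_c}N_{T+1}(x)+D\sum_{x\in\mathcal X_-(M^\dagger)}N_{T+1}(x)\le\varepsilon T-u\Big)\le\exp\Big(-\frac{2u^2}{T D^2}\Big).$$ -/

import Mathlib

open MeasureTheory ProbabilityTheory Filter Topology

namespace RegretMDP

universe u v

/-- State-action pairs `(s, a)` with `a` an action available in the state `s`. -/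
def Pair (S : Type u) (A : S → Type v) : Type (max u v) := Σ s : S, A s

namespace Pair

variable {S : Type u} {A : S → Type v}

instance [Fintype S] [∀ s, Fintype (A s)] : Fintype (Pair S A) :=
  inferInstanceAs (Fintype (Σ s : S, A s))

instance [DecidableEq S] [∀ s, DecidableEq (A s)] : DecidableEq (Pair S A) :=
  inferInstanceAs (DecidableEq (Σ s : S, A s))

/-- The (finite) set of pairs carries the discrete sigma-algebra. -/
instance : MeasurableSpace (Pair S A) := ⊤

instance : DiscreteMeasurableSpace (Pair S A) := ⟨fun _ => trivial⟩

end Pair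

/-- A Markov decision process with pair space `Pair S A`: a transition kernel and, for each pair,
a reward distribution with a finite mean. -/
structure MDP (S : Type u) (A : S → Type v) where
  kernel : Pair S A → PMF S
  reward : Pair S A → ProbabilityMeasure ℝ
  integrable_reward : ∀ x, Integrable (fun r : ℝ => r) (reward x : Measure ℝ)

/-- Stationary deterministic policies. -/
abbrev Policy (S : Type u) (A : S → Type v) : Type (max u v) := (s : S) → A s

/-- One round of interaction: the pair that is played and the reward that is received. -/
abbrev Obs (S : Type u) (A : S → Type v) : Type (max u v) := Pair S A × ℝ

/-- A learning agent: given the `n` rounds observed so far and the current state, it draws its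
next action at random, in a measurable way with respect to the history. -/
structure Learner (S : Type u) (A : S → Type v) where
  act : (n : ℕ) → (Fin n → Obs S A) → (s : S) → PMF (A s)
  measurable_act : ∀ n s a, Measurable (fun h : Fin n → Obs S A => act n h s a)

noncomputable section

namespace MDP

variable {S : Type u} {A : S → Type v}

/-- The mean reward `r(x)`. -/
def meanReward (M : MDP S A) (x : Pair S A) : ℝ := ∫ r, r ∂(M.reward x : Measure ℝ)

/-- The transition matrix `P_π` of the Markov chain induced by a policy. -/
def policyMatrix (M : MDP S A) (π : Policy S A) : Matrix S S ℝ :=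
  Matrix.of fun s s' => (M.kernel ⟨s, π s⟩ s').toReal

/-- The mean rewards of the pairs `(s, π s)`. -/
def policyReward (M : MDP S A) (π : Policy S A) (s : S) : ℝ := M.meanReward ⟨s, π s⟩

/-- `expect M π t f s` is the expectation of `f (S_t)` for the chain of `π` started at `S_0 = s`. -/
def expect [Fintype S] [DecidableEq S] (M : MDP S A) (π : Policy S A) (t : ℕ) (f : S → ℝ)
    (s : S) : ℝ :=
  ((M.policyMatrix π ^ t).mulVec f) s

/-- The gain `g^π(s) = lim_T (1/T) E_s^π[R_1 + ... + R_T]`. -/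
def gain [Fintype S] [DecidableEq S] (M : MDP S A) (π : Policy S A) (s : S) : ℝ :=
  limUnder atTop fun T : ℕ =>
    (∑ t ∈ Finset.range T, M.expect π t (M.policyReward π) s) / (T : ℝ)

/-- The bias `h^π(s)`: the Cesàro limit in `T` of `E_s^π[∑_{t ≤ T} (R_t - g^π(S_t))]`. -/
def bias [Fintype S] [DecidableEq S] (M : MDP S A) (π : Policy S A) (s : S) : ℝ :=
  limUnder atTop fun N : ℕ =>
    (∑ T ∈ Finset.Icc 1 N, ∑ t ∈ Finset.range T,
      M.expect π t (fun s' => M.policyReward π s' - M.gain π s') s) / (N : ℝ)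

/-- The optimal gain `g^*(s) = max_π g^π(s)`. -/
def optimalGain [Fintype S] [DecidableEq S] (M : MDP S A) (s : S) : ℝ :=
  ⨆ π : Policy S A, M.gain π s

/-- The gain-optimal policies `Π^*(M)`. -/
def optimalPolicies [Fintype S] [DecidableEq S] (M : MDP S A) : Set (Policy S A) :=
  {π | ∀ s, M.gain π s = M.optimalGain s}

/-- The optimal bias `h^*(s) = max {h^π(s) : π ∈ Π^*(M)}`. -/
def optimalBias [Fintype S] [DecidableEq S] (M : MDP S A) (s : S) : ℝ :=
  ⨆ π : M.optimalPolicies, M.bias π.1 s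

/-- The Bellman gap `Δ^*(s, a) = h^*(s) + g^*(s) - r(s, a) - ∑ s', p(s' | s, a) h^*(s')`. -/
def gap [Fintype S] [DecidableEq S] (M : MDP S A) (x : Pair S A) : ℝ :=
  M.optimalBias x.1 + M.optimalGain x.1 - M.meanReward x
    - ∑ s', (M.kernel x s').toReal * M.optimalBias s'

/-- `π` moves from `s` to `s'` with positive probability in some number of steps. -/
def Reaches (M : MDP S A) (π : Policy S A) : S → S → Prop :=
  Relation.ReflTransGen fun s s' => M.kernel ⟨s, π s⟩ s' ≠ 0

/-- Recurrent states of the (finite) chain of `π`: those that can be reached back from everywhere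
that they lead to. -/
def IsRecurrent (M : MDP S A) (π : Policy S A) (s : S) : Prop :=
  ∀ s', M.Reaches π s s' → M.Reaches π s' s

/-- The optimal pairs `X^*(M)`: the pairs that are recurrent under some gain-optimal policy. -/
def optimalPairs [Fintype S] [DecidableEq S] (M : MDP S A) : Set (Pair S A) :=
  {x | ∃ π ∈ M.optimalPolicies, M.IsRecurrent π x.1 ∧ π x.1 = x.2}

open Classical in
/-- The suboptimal pairs `X_-(M)`: those with a positive gap. -/
def suboptimalPairs [Fintype S] [∀ s, Fintype (A s)] [DecidableEq S] (M : MDP S A) :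
    Finset (Pair S A) :=
  Finset.univ.filter fun x => 0 < M.gap x

/-- Every state can be reached from every other one. -/
def IsCommunicating (M : MDP S A) : Prop :=
  ∀ s s', Relation.ReflTransGen (fun s₁ s₂ => ∃ a : A s₁, M.kernel ⟨s₁, a⟩ s₂ ≠ 0) s s'

/-- `M.Dominates M₀` is `M ≫ M₀`: kernels and reward distributions of `M₀` are absolutely
continuous with respect to those of `M`, pair by pair. -/
def Dominates (M M₀ : MDP S A) : Prop :=
  ∀ x, (∀ s, M.kernel x s = 0 → M₀.kernel x s = 0) ∧
    (M₀.reward x : Measure ℝ) ≪ (M.reward x : Measure ℝ)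

/-- The alternative set of `M` within the ambient set of models `models`. -/
def alternative [Fintype S] [DecidableEq S] (models : Set (MDP S A)) (M : MDP S A) :
    Set (MDP S A) :=
  {M' | M' ∈ models ∧ M'.Dominates M ∧ M'.optimalPolicies ∩ M.optimalPolicies = ∅}

open Classical in
/-- The optimal pairs of `M'` that have a positive gap in `M`. -/
def confusingPairs [Fintype S] [∀ s, Fintype (A s)] [DecidableEq S] (M M' : MDP S A) :
    Finset (Pair S A) :=
  Finset.univ.filter fun x => x ∈ M'.optimalPairs ∧ 0 < M.gap x

end MDP

section Interaction

variable {S : Type u} {A : S → Type v}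

/-- Law of the next pair `(S, A)` when the state is drawn from `q` and then the action is drawn by
the learner, who has observed the history `h`. -/
def pairLaw (Λ : Learner S A) {n : ℕ} (q : PMF S) (h : Fin n → Obs S A) : PMF (Pair S A) :=
  q.bind fun s => (Λ.act n h s).map fun a => (⟨s, a⟩ : Pair S A)

lemma measurable_pairLaw_apply [Countable S] (Λ : Learner S A) {n : ℕ} (q : PMF S)
    (x : Pair S A) : Measurable fun h : Fin n → Obs S A => pairLaw Λ q h x := by
  classical
  obtain ⟨s₀, a₀⟩ := x
  have hmap : ∀ s, Measurable fun h : Fin n → Obs S A =>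
      ((Λ.act n h s).map fun a => (⟨s, a⟩ : Pair S A)) ⟨s₀, a₀⟩ := by
    intro s
    by_cases hs : s = s₀
    · subst hs
      have : (fun h : Fin n → Obs S A =>
          ((Λ.act n h s).map fun a => (⟨s, a⟩ : Pair S A)) ⟨s, a₀⟩)
            = fun h => Λ.act n h s a₀ := by
        funext h
        rw [PMF.map_apply, tsum_eq_single a₀]
        · simp
        · intro a ha
          rw [if_neg]
          intro hc
          exact ha (eq_of_heq (Sigma.mk.inj hc).2).symm
      rw [this]
      exact Λ.measurable_act n s a₀
    · have : (fun h : Fin n → Obs S A =>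
          ((Λ.act n h s).map fun a => (⟨s, a⟩ : Pair S A)) ⟨s₀, a₀⟩) = fun _ => 0 := by
        funext h
        rw [PMF.map_apply]
        refine ENNReal.tsum_eq_zero.2 fun a => if_neg ?_
        intro hc
        exact hs (Sigma.mk.inj hc).1.symm
      rw [this]
      exact measurable_const
  have hsum : (fun h : Fin n → Obs S A => pairLaw Λ q h ⟨s₀, a₀⟩) = fun h =>
      ∑' s, q s * ((Λ.act n h s).map fun a => (⟨s, a⟩ : Pair S A)) ⟨s₀, a₀⟩ :=
    funext fun h => PMF.bind_apply _ _ _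
  rw [hsum]
  exact Measurable.tsum fun s => (hmap s).const_mul _

/-- A history indexed by the times `0, ..., n`, listed as `n + 1` rounds. -/
def toHistory {n : ℕ} (h : (i : Finset.Iic n) → Obs S A) : Fin (n + 1) → Obs S A :=
  fun i => h ⟨i, Finset.mem_Iic.2 (Nat.le_of_lt_succ i.2)⟩

lemma measurable_toHistory {n : ℕ} :
    Measurable (toHistory : ((i : Finset.Iic n) → Obs S A) → Fin (n + 1) → Obs S A) :=
  measurable_pi_lambda _ fun _ => measurable_pi_apply _

/-- Law of the next pair given the first `n + 1` rounds: the next state is drawn from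
`p(· | x)` for the last pair `x` that was played, then the learner draws an action. -/
def nextPairLaw (M : MDP S A) (Λ : Learner S A) (n : ℕ) (h : (i : Finset.Iic n) → Obs S A) :
    PMF (Pair S A) :=
  pairLaw Λ (M.kernel (toHistory h (Fin.last n)).1) (toHistory h)

variable [Fintype S] [∀ s, Fintype (A s)]

lemma measurable_nextPairLaw (M : MDP S A) (Λ : Learner S A) (n : ℕ) :
    Measurable fun h : (i : Finset.Iic n) → Obs S A => (nextPairLaw M Λ n h).toMeasure := by
  have hpt : ∀ x : Pair S A, Measurable fun h : (i : Finset.Iic n) → Obs S A =>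
      nextPairLaw M Λ n h x := by
    intro x
    have h1 : Measurable (Function.uncurry fun (g : Fin (n + 1) → Obs S A) (y : Pair S A) =>
        pairLaw Λ (M.kernel y) g x) :=
      measurable_from_prod_countable_left fun y => measurable_pairLaw_apply Λ (M.kernel y) x
    exact h1.comp (measurable_toHistory.prodMk
      (measurable_fst.comp ((measurable_pi_apply (Fin.last n)).comp measurable_toHistory)))
  refine Measure.measurable_of_measurable_coe _ fun s _ => ?_
  simp only [PMF.toMeasure_apply_fintype]
  refine Finset.measurable_sum _ fun x _ => ?_
  by_cases hx : x ∈ s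
  · simpa only [Set.indicator_of_mem hx] using hpt x
  · simp only [Set.indicator_of_notMem hx]
    exact measurable_const

/-- The reward distributions as a kernel. -/
def rewardKernel (M : MDP S A) : Kernel (Pair S A) ℝ where
  toFun x := (M.reward x : Measure ℝ)
  measurable' := measurable_of_countable _

instance (M : MDP S A) : IsMarkovKernel (rewardKernel M) :=
  ⟨fun x => inferInstanceAs (IsProbabilityMeasure (M.reward x : Measure ℝ))⟩

/-- The law of the next pair given the past, as a kernel. -/
def pairKernel (M : MDP S A) (Λ : Learner S A) (n : ℕ) :
    Kernel ((i : Finset.Iic n) → Obs S A) (Pair S A) where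
  toFun h := (nextPairLaw M Λ n h).toMeasure
  measurable' := measurable_nextPairLaw M Λ n

instance (M : MDP S A) (Λ : Learner S A) (n : ℕ) : IsMarkovKernel (pairKernel M Λ n) :=
  ⟨fun h => inferInstanceAs (IsProbabilityMeasure (nextPairLaw M Λ n h).toMeasure)⟩

/-- The law of the next round given the past: the next pair, then its reward. -/
def stepKernel (M : MDP S A) (Λ : Learner S A) (n : ℕ) :
    Kernel ((i : Finset.Iic n) → Obs S A) (Obs S A) :=
  pairKernel M Λ n ⊗ₖ Kernel.prodMkLeft _ (rewardKernel M)

instance (M : MDP S A) (Λ : Learner S A) (n : ℕ) : IsMarkovKernel (stepKernel M Λ n) :=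
  inferInstanceAs (IsMarkovKernel (pairKernel M Λ n ⊗ₖ Kernel.prodMkLeft _ (rewardKernel M)))

/-- The law of the first round, started at the state `s₀`. -/
def initialLaw (M : MDP S A) (Λ : Learner S A) (s₀ : S) : Measure (Obs S A) :=
  (pairLaw Λ (n := 0) (PMF.pure s₀) Fin.elim0).toMeasure ⊗ₘ rewardKernel M

/-- The law of the infinite sequence of rounds when `Λ` interacts with `M` from the state `s₀`;
the coordinate `t` of a trajectory is the pair played, and the reward received, at time `t + 1`. -/
def interactionLaw (M : MDP S A) (Λ : Learner S A) (s₀ : S) : Measure (ℕ → Obs S A) :=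
  Kernel.trajMeasure (X := fun _ : ℕ => Obs S A) (initialLaw M Λ s₀) (stepKernel M Λ)

instance (M : MDP S A) (Λ : Learner S A) (s₀ : S) :
    IsProbabilityMeasure (initialLaw M Λ s₀) := by
  unfold initialLaw
  infer_instance

instance (M : MDP S A) (Λ : Learner S A) (s₀ : S) :
    IsProbabilityMeasure (interactionLaw M Λ s₀) := by
  unfold interactionLaw
  infer_instance

end Interaction

/-- The number `N_{T+1}(x)` of times that the pair `x` is played during the first `T` rounds. -/
def visits {S : Type u} {A : S → Type v} [DecidableEq S] [∀ s, DecidableEq (A s)]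
    (T : ℕ) (x : Pair S A) (ω : ℕ → Obs S A) : ℕ :=
  ((Finset.range T).filter fun t => (ω t).1 = x).card

end

end RegretMDP

/-!
The theorem is a drift argument for a bounded potential on the states. Call a pair *good* if it is
neither suboptimal in `M'` nor confusing.

No nonempty set of states is closed, in `M'`, under good pairs. Indeed, such a set would contain a
recurrent class `C` of good pairs. Since `M` is communicating, so is `M'`, and a single policy `π`
uses these pairs on `C` and leads to `C` from everywhere, in both models. The gaps of `M'` are not
positive on `C`, and averaging the inequality `h + g ≤ r + P h` over `C` makes `π` gain optimal in
`M'`. Hence the pairs of `C` are optimal in `M'`; as they are not confusing, their gaps in `M` are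
not positive either, and `C` is closed in `M` because `M'` dominates `M`. So `π` is gain optimal in
`M` as well, which contradicts the disjointness of the two sets of optimal policies
(`MDP.eq_empty_of_isClosedUnder`). Only the inequality for nonpositive gaps and the constancy of the
optimal gain are used, never the Bellman equation. The averaging is a maximum principle, applied to
the Poisson equation of the chain (`exists_poisson`, `MDP.le_gain_of_isClosedUnder`); the Poisson
equation also gives the convergence of the averages that define the gain.

Therefore states have levels such that each good pair leads with positive probability to a lower
level (`MDP.exists_level`). A function `φ` with values in `[0, 1]` that decreases geometrically in
the level grows in expectation by at least `ε` at each good pair, and by at least `ε - 1` at the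
others (`MDP.exists_potential`). Summed over `T` rounds, the number of rounds at bad pairs is at
least `ε T - 1` plus a sum of martingale differences, each in an interval of length `1` given the
past. The Azuma-Hoeffding inequality for this sum (`measure_sum_potentialNoise_le`) gives the
theorem with `D = 1`.
-/

namespace RegretMDP

open Matrix

/-! ### Cesàro averages of a finite Markov chain -/

section Cesaro

variable {S : Type*} [Fintype S] [DecidableEq S]

lemma abs_mulVec_le_of_mem_rowStochastic {P : Matrix S S ℝ} (hP : P ∈ rowStochastic ℝ S)
    {f : S → ℝ} {B : ℝ} (hf : ∀ s, |f s| ≤ B) (s : S) : |(P *ᵥ f) s| ≤ B :=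
  calc |∑ s', P s s' * f s'| ≤ ∑ s', |P s s' * f s'| := Finset.abs_sum_le_sum_abs _ _
    _ ≤ ∑ s', P s s' * B := by
        refine Finset.sum_le_sum fun s' _ => ?_
        rw [abs_mul, abs_of_nonneg (nonneg_of_mem_rowStochastic hP)]
        exact mul_le_mul_of_nonneg_left (hf s') (nonneg_of_mem_rowStochastic hP)
    _ = B := by rw [← Finset.sum_mul, sum_row_of_mem_rowStochastic hP, one_mul]

lemma sum_range_pow_mulVec {P : Matrix S S ℝ} {r a w : S → ℝ} (ha : P *ᵥ a = a)
    (hr : r = a + (w - P *ᵥ w)) (T : ℕ) :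
    ∑ t ∈ Finset.range T, P ^ t *ᵥ r = (T : ℝ) • a + (w - P ^ T *ᵥ w) := by
  have hpow : ∀ t : ℕ, P ^ t *ᵥ a = a := by
    intro t
    induction t with
    | zero => simp
    | succ t ih => rw [pow_succ, ← mulVec_mulVec, ha, ih]
  induction T with
  | zero => simp
  | succ T ih =>
    rw [Finset.sum_range_succ, ih, hr, mulVec_add, mulVec_sub, hpow, mulVec_mulVec, ← pow_succ]
    push_cast
    module

lemma tendsto_cesaro_of_poisson {P : Matrix S S ℝ} (hP : P ∈ rowStochastic ℝ S)
    {r a w : S → ℝ} (ha : P *ᵥ a = a) (hr : r = a + (w - P *ᵥ w)) (s : S) :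
    Tendsto (fun T : ℕ => (∑ t ∈ Finset.range T, (P ^ t *ᵥ r) s) / (T : ℝ)) atTop (𝓝 (a s)) := by
  obtain ⟨B, hB⟩ : ∃ B, ∀ i, |w i| ≤ B :=
    ⟨∑ i, |w i|, fun i => Finset.single_le_sum (f := fun i => |w i|)
      (fun _ _ => abs_nonneg _) (Finset.mem_univ i)⟩
  have hlim : Tendsto (fun T : ℕ => a s + (w s - (P ^ T *ᵥ w) s) / (T : ℝ)) atTop
      (𝓝 (a s + 0)) := by
    refine tendsto_const_nhds.add ?_
    refine squeeze_zero_norm (a := fun T : ℕ => (B + B) / (T : ℝ)) (fun T => ?_)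
      (tendsto_const_div_atTop_nhds_zero_nat _)
    rw [Real.norm_eq_abs, abs_div, Nat.abs_cast]
    have h := abs_mulVec_le_of_mem_rowStochastic (pow_mem hP T) hB s
    have h' := hB s
    gcongr
    exact (abs_sub _ _).trans (add_le_add h' h)
  rw [add_zero] at hlim
  refine hlim.congr' ?_
  filter_upwards [eventually_gt_atTop 0] with T hT
  have h := congrFun (sum_range_pow_mulVec ha hr T) s
  simp only [Finset.sum_apply, Pi.add_apply, Pi.smul_apply, Pi.sub_apply, smul_eq_mul] at h
  rw [h]
  have : (T : ℝ) ≠ 0 := by positivity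
  field_simp

/-- The Poisson equation of a finite Markov chain. The chain is power bounded, so the kernel and
the range of `1 - P` meet only at `0`, and by rank-nullity they are complementary. -/
lemma exists_poisson {P : Matrix S S ℝ} (hP : P ∈ rowStochastic ℝ S) (r : S → ℝ) :
    ∃ a w : S → ℝ, P *ᵥ a = a ∧ r = a + (w - P *ᵥ w) := by
  let L : (S → ℝ) →ₗ[ℝ] (S → ℝ) := LinearMap.id - P.mulVecLin
  have hL : ∀ v, L v = v - P *ᵥ v := fun v => rfl
  have hdisj : Disjoint (LinearMap.ker L) (LinearMap.range L) := by
    rw [Submodule.disjoint_def]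
    rintro v hv ⟨w, rfl⟩
    have hfix : P *ᵥ L w = L w := (sub_eq_zero.1 ((hL _).symm.trans hv)).symm
    -- The averages of `L w = 0 + (w - P w) = L w + (0 - P 0)` tend both to `0` and to `L w`.
    funext s
    exact tendsto_nhds_unique
      (tendsto_cesaro_of_poisson hP (r := L w) (w := 0) hfix (by simp) s)
      (tendsto_cesaro_of_poisson hP (a := 0) (w := w) (by simp) (by rw [hL, zero_add]) s)
  have hcompl := (Submodule.isCompl_iff_disjoint _ _ (by
    rw [add_comm, LinearMap.finrank_range_add_finrank_ker])).2 hdisj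
  have hr : r ∈ LinearMap.ker L ⊔ LinearMap.range L := by
    rw [hcompl.sup_eq_top]; trivial
  obtain ⟨a, ha, _, ⟨w, rfl⟩, h⟩ := Submodule.mem_sup.1 hr
  exact ⟨a, w, (sub_eq_zero.1 ((hL _).symm.trans ha)).symm, h.symm⟩

end Cesaro

/-! ### Maximum principle -/

section MaximumPrinciple

variable {S : Type*} [Fintype S]

lemma sum_toReal_pmf (p : PMF S) : ∑ s, (p s).toReal = 1 := by
  rw [← ENNReal.toReal_sum fun s _ => p.apply_ne_top s, ← ENNReal.toReal_one, ← p.tsum_coe,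
    tsum_fintype]

lemma sum_toReal_mul_le {p : PMF S} {f : S → ℝ} {m : ℝ} (h : ∀ s, p s ≠ 0 → f s ≤ m) :
    ∑ s, (p s).toReal * f s ≤ m :=
  calc ∑ s, (p s).toReal * f s ≤ ∑ s, (p s).toReal * m := by
        refine Finset.sum_le_sum fun s _ => ?_
        by_cases hs : p s = 0
        · simp [hs]
        · exact mul_le_mul_of_nonneg_left (h s hs) ENNReal.toReal_nonneg
    _ = m := by rw [← Finset.sum_mul, sum_toReal_pmf, one_mul]

lemma eq_of_sum_toReal_mul_eq {p : PMF S} {f : S → ℝ} {m : ℝ} (h : ∀ s, p s ≠ 0 → m ≤ f s)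
    (hm : ∑ s, (p s).toReal * f s = m) {s : S} (hs : p s ≠ 0) : f s = m := by
  have hnn : ∀ s ∈ Finset.univ, 0 ≤ (p s).toReal * (f s - m) := by
    intro s _
    by_cases hs : p s = 0
    · simp [hs]
    · exact mul_nonneg ENNReal.toReal_nonneg (sub_nonneg.2 (h s hs))
  have hzero : ∑ s, (p s).toReal * (f s - m) = 0 := by
    simp_rw [mul_sub]
    rw [Finset.sum_sub_distrib, hm, ← Finset.sum_mul, sum_toReal_pmf, one_mul, sub_self]
  have h0 := (Finset.sum_eq_zero_iff_of_nonneg hnn).1 hzero s (Finset.mem_univ s)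
  have hp : (p s).toReal ≠ 0 := ENNReal.toReal_ne_zero.2 ⟨hs, p.apply_ne_top s⟩
  exact sub_eq_zero.1 ((mul_eq_zero.1 h0).resolve_left hp)

end MaximumPrinciple

namespace MDP

variable {S : Type*} {A : S → Type*}

/-! ### Closed sets of states and gains -/

/-- The set `C` of states is closed under `π` in `M`: the chain of `π` cannot leave it. -/
def IsClosedUnder (M : MDP S A) (π : Policy S A) (C : Set S) : Prop :=
  ∀ s ∈ C, ∀ s', M.kernel ⟨s, π s⟩ s' ≠ 0 → s' ∈ C

lemma IsClosedUnder.mem_of_reaches {M : MDP S A} {π : Policy S A} {C : Set S}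
    (hC : M.IsClosedUnder π C) {s s' : S} (hs : s ∈ C) (h : M.Reaches π s s') : s' ∈ C := by
  induction h with
  | refl => exact hs
  | tail _ hstep ih => exact hC _ ih _ hstep

lemma IsClosedUnder.congr {M : MDP S A} {π π' : Policy S A} {C : Set S}
    (hC : M.IsClosedUnder π C) (h : ∀ s ∈ C, π' s = π s) : M.IsClosedUnder π' C := by
  intro s hs s' hs'
  rw [h s hs] at hs'
  exact hC s hs s' hs'

lemma IsClosedUnder.of_dominates {M M' : MDP S A} (hdom : M'.Dominates M) {π : Policy S A}
    {C : Set S} (hC : M'.IsClosedUnder π C) : M.IsClosedUnder π C :=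
  fun s hs s' hs' => hC s hs s' fun h => hs' ((hdom _).1 s' h)

lemma Reaches.of_dominates {M M' : MDP S A} (hdom : M'.Dominates M) {π : Policy S A} {s s' : S}
    (h : M.Reaches π s s') : M'.Reaches π s s' :=
  Relation.ReflTransGen.mono (fun _ _ h1 h2 => h1 ((hdom _).1 _ h2)) _ _ h

lemma IsCommunicating.of_dominates {M M' : MDP S A} (hdom : M'.Dominates M)
    (h : M.IsCommunicating) : M'.IsCommunicating := fun s s' =>
  Relation.ReflTransGen.mono (fun _ _ ⟨a, h1⟩ => ⟨a, fun h2 => h1 ((hdom _).1 _ h2)⟩) _ _ (h s s')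

variable [Fintype S] [DecidableEq S]

lemma policyMatrix_mem_rowStochastic (M : MDP S A) (π : Policy S A) :
    M.policyMatrix π ∈ rowStochastic ℝ S :=
  mem_rowStochastic_iff_sum.2
    ⟨fun _ _ => ENNReal.toReal_nonneg, fun s => sum_toReal_pmf (M.kernel ⟨s, π s⟩)⟩

/-- The gain is a harmonic function, and it solves the Poisson equation with some `w`. -/
lemma exists_gain_poisson (M : MDP S A) (π : Policy S A) :
    (∀ s, ∑ s', (M.kernel ⟨s, π s⟩ s').toReal * M.gain π s' = M.gain π s) ∧
    ∃ w : S → ℝ, ∀ s, M.meanReward ⟨s, π s⟩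
      = M.gain π s + (w s - ∑ s', (M.kernel ⟨s, π s⟩ s').toReal * w s') := by
  have hP := M.policyMatrix_mem_rowStochastic π
  obtain ⟨a, w, ha, hr⟩ := exists_poisson hP (M.policyReward π)
  have hgain : M.gain π = a := funext fun s => (tendsto_cesaro_of_poisson hP ha hr s).limUnder_eq
  rw [hgain]
  exact ⟨congrFun ha, w, congrFun hr⟩

/-- On a closed set where the rewards dominate `g + h - P h`, the gain is at least `g`. If the
minimum of the gain over the set were below `g`, then on the closed set of minimizers `h - w` would
strictly increase in expectation at each step, which is impossible where it is maximal. -/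
lemma le_gain_of_isClosedUnder {M : MDP S A} {π : Policy S A} {C : Set S}
    (hC : M.IsClosedUnder π C) {g : ℝ} {h : S → ℝ}
    (hle : ∀ s ∈ C, h s + g
      ≤ M.meanReward ⟨s, π s⟩ + ∑ s', (M.kernel ⟨s, π s⟩ s').toReal * h s')
    {s : S} (hs : s ∈ C) : g ≤ M.gain π s := by
  obtain ⟨hharm, w, hw⟩ := M.exists_gain_poisson π
  obtain ⟨m, hmC, hmin⟩ := Set.exists_min_image C (M.gain π) C.toFinite ⟨s, hs⟩
  refine le_trans ?_ (hmin s hs)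
  by_contra! hlt
  let C' : Set S := {s ∈ C | M.gain π s = M.gain π m}
  have hC' : M.IsClosedUnder π C' := fun s hs s' hs' =>
    ⟨hC s hs.1 s' hs', eq_of_sum_toReal_mul_eq (fun y hy => hmin y (hC s hs.1 y hy))
      ((hharm s).trans hs.2) hs'⟩
  obtain ⟨y, hy, hmax⟩ := Set.exists_max_image C' (fun s => h s - w s) C'.toFinite ⟨m, hmC, rfl⟩
  have h1 := sum_toReal_mul_le (p := M.kernel ⟨y, π y⟩) (f := fun s => h s - w s)
    fun s hs => hmax s (hC' y hy s hs)
  have h2 := hle y hy.1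
  have h3 := hw y
  have h4 := hy.2
  simp only [mul_sub, Finset.sum_sub_distrib] at h1
  linarith

/-- If every state leads to a set on which the gain is at least `g`, then the gain is at least `g`
everywhere, because the set where a harmonic function is minimal is closed. -/
lemma le_gain_of_reaches {M : MDP S A} {π : Policy S A} {C : Set S} {g : ℝ}
    (hreach : ∀ s, ∃ c ∈ C, M.Reaches π s c) (hg : ∀ s ∈ C, g ≤ M.gain π s) (s : S) :
    g ≤ M.gain π s := by
  obtain ⟨hharm, -⟩ := M.exists_gain_poisson π
  obtain ⟨m, -, hmin⟩ := Set.exists_min_image Set.univ (M.gain π) Set.finite_univ ⟨s, trivial⟩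
  have hclosed : M.IsClosedUnder π {s | M.gain π s = M.gain π m} := fun s hs s' hs' =>
    eq_of_sum_toReal_mul_eq (fun y _ => hmin y trivial) ((hharm s).trans hs) hs'
  obtain ⟨c, hc, hmc⟩ := hreach m
  have h := hclosed.mem_of_reaches (s := m) rfl hmc
  exact ((hg c hc).trans_eq h).trans (hmin s trivial)

/-! ### Steering towards a closed set -/

omit [Fintype S] [DecidableEq S] in
/-- In a communicating MDP any policy can be modified outside of a nonempty set so that it leads
from every state to that set. -/
lemma exists_policy_reaches {M : MDP S A} (hcomm : M.IsCommunicating) {C : Set S}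
    (hC : C.Nonempty) (π : Policy S A) :
    ∃ π' : Policy S A, (∀ s ∈ C, π' s = π s) ∧ ∀ s, ∃ c ∈ C, M.Reaches π' s c := by
  classical
  -- `lvl n` is the set of states from which `C` can be reached in at most `n` steps.
  let lvl : ℕ → Set S := fun n => Nat.rec (motive := fun _ => Set S) C
    (fun _ W => W ∪ {s | ∃ a s', M.kernel ⟨s, a⟩ s' ≠ 0 ∧ s' ∈ W}) n
  have hsucc : ∀ n, lvl (n + 1)
      = lvl n ∪ {s | ∃ a s', M.kernel ⟨s, a⟩ s' ≠ 0 ∧ s' ∈ lvl n} := fun n => rfl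
  have hex : ∀ s, ∃ n, s ∈ lvl n := by
    obtain ⟨c, hc⟩ := hC
    intro s
    induction hcomm s c using Relation.ReflTransGen.head_induction_on with
    | refl => exact ⟨0, hc⟩
    | head hstep _ ih =>
      obtain ⟨n, hn⟩ := ih
      obtain ⟨a, ha⟩ := hstep
      exact ⟨n + 1, (hsucc n).symm ▸ Or.inr ⟨a, _, ha, hn⟩⟩
  have hstep : ∀ s : S, s ∉ C →
      ∃ a s', M.kernel ⟨s, a⟩ s' ≠ 0 ∧ ∃ k, k < Nat.find (hex s) ∧ s' ∈ lvl k := by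
    intro s hs
    obtain ⟨k, hk⟩ : ∃ k, Nat.find (hex s) = k + 1 := by
      refine Nat.exists_eq_succ_of_ne_zero fun h0 => hs ?_
      have := Nat.find_spec (hex s)
      rwa [h0] at this
    have hmem := Nat.find_spec (hex s)
    rw [hk, hsucc] at hmem
    obtain ⟨a, s', h1, h2⟩ := hmem.resolve_left (Nat.find_min (hex s) (hk.symm ▸ Nat.lt_succ_self k))
    exact ⟨a, s', h1, k, hk ▸ Nat.lt_succ_self k, h2⟩
  choose act nxt hact k hk hnxt using hstep
  refine ⟨fun s => if hs : s ∈ C then π s else act s hs, fun s hs => dif_pos hs, ?_⟩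
  have key : ∀ n s, s ∈ lvl n → ∃ c ∈ C,
      M.Reaches (fun s => if hs : s ∈ C then π s else act s hs) s c := by
    intro n
    induction n using Nat.strong_induction_on with
    | _ n ih =>
      intro s hs
      by_cases hsC : s ∈ C
      · exact ⟨s, hsC, Relation.ReflTransGen.refl⟩
      · obtain ⟨c, hc, hr⟩ := ih (k s hsC) ((hk s hsC).trans_le (Nat.find_min' (hex s) hs))
          (nxt s hsC) (hnxt s hsC)
        refine ⟨c, hc, Relation.ReflTransGen.head ?_ hr⟩
        simpa only [dif_neg hsC] using hact s hsC
  exact fun s => (hex s).elim fun n hn => key n s hn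

omit [DecidableEq S] in
/-- A nonempty closed set contains a nonempty closed set that is a recurrent class of every policy
that agrees with the given one on it. -/
lemma IsClosedUnder.exists_recurrent {M : MDP S A} {π : Policy S A} {B : Set S}
    (hB : M.IsClosedUnder π B) (hne : B.Nonempty) :
    ∃ C ⊆ B, C.Nonempty ∧ M.IsClosedUnder π C ∧
      ∀ π' : Policy S A, (∀ s ∈ C, π' s = π s) → ∀ s ∈ C, M.IsRecurrent π' s := by
  obtain ⟨C, ⟨hCne, hCB, hC⟩, hmin⟩ := Set.Finite.exists_minimal
    (s := {C : Set S | C.Nonempty ∧ C ⊆ B ∧ M.IsClosedUnder π C}) (Set.toFinite _)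
    ⟨B, hne, subset_rfl, hB⟩
  refine ⟨C, hCB, hCne, hC, fun π' hπ' s hs s' hss' => ?_⟩
  have hC' := hC.congr hπ'
  have hs' := hC'.mem_of_reaches hs hss'
  -- By minimality of `C`, the set of the states that `s'` leads to is all of `C`.
  have hsub : {y | M.Reaches π' s' y} ⊆ C := fun y hy => hC'.mem_of_reaches hs' hy
  refine hmin (y := {y | M.Reaches π' s' y})
    ⟨⟨s', Relation.ReflTransGen.refl⟩, hsub.trans hCB, ?_⟩ hsub hs
  intro y hy z hz
  rw [← hπ' y (hsub hy)] at hz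
  exact Relation.ReflTransGen.tail hy hz

variable [∀ s, Fintype (A s)]

lemma mem_suboptimalPairs {M : MDP S A} {x : Pair S A} : x ∈ M.suboptimalPairs ↔ 0 < M.gap x := by
  classical
  simp [suboptimalPairs]

lemma mem_confusingPairs {M M' : MDP S A} {x : Pair S A} :
    x ∈ confusingPairs M M' ↔ x ∈ M'.optimalPairs ∧ 0 < M.gap x := by
  classical
  simp [confusingPairs]

lemma gain_le_optimalGain (M : MDP S A) (π : Policy S A) (s : S) :
    M.gain π s ≤ M.optimalGain s :=
  le_ciSup (f := fun π : Policy S A => M.gain π s) (Set.finite_range _).bddAbove π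

/-- In a communicating MDP the optimal gain does not depend on the state. -/
lemma IsCommunicating.optimalGain_eq [∀ s, Nonempty (A s)] {M : MDP S A}
    (hcomm : M.IsCommunicating) (s s' : S) : M.optimalGain s = M.optimalGain s' := by
  suffices h : ∀ s s', M.optimalGain s ≤ M.optimalGain s' from le_antisymm (h s s') (h s' s)
  clear s s'
  intro s s'
  refine ciSup_le fun π => ?_
  obtain ⟨hharm, w, hw⟩ := M.exists_gain_poisson π
  obtain ⟨m, -, hmax⟩ := Set.exists_max_image Set.univ (M.gain π) Set.finite_univ ⟨s, trivial⟩
  refine (hmax s trivial).trans ?_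
  let C : Set S := {s | M.gain π s = M.gain π m}
  have hC : M.IsClosedUnder π C := by
    intro y hy z hz
    refine neg_injective (eq_of_sum_toReal_mul_eq (f := fun y => -M.gain π y)
      (fun x _ => neg_le_neg (hmax x trivial)) ?_ hz)
    simp only [mul_neg, Finset.sum_neg_distrib, hharm]
    exact congrArg _ hy
  obtain ⟨π', hag, hreach⟩ := exists_policy_reaches hcomm (C := C) ⟨m, rfl⟩ π
  refine (le_gain_of_reaches hreach (fun y hy => ?_) s').trans (M.gain_le_optimalGain π' s')
  refine le_gain_of_isClosedUnder (hC.congr hag) (h := w) (fun z hz => ?_) hy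
  rw [hag z hz, hw z, show M.gain π z = M.gain π m from hz]
  linarith

/-- In a communicating MDP a policy is gain optimal if it leads from every state to a closed set on
which its gaps are not positive. -/
lemma IsCommunicating.mem_optimalPolicies [∀ s, Nonempty (A s)] {M : MDP S A}
    (hcomm : M.IsCommunicating) {π : Policy S A} {C : Set S} (hC : M.IsClosedUnder π C)
    (hreach : ∀ s, ∃ c ∈ C, M.Reaches π s c) (hgap : ∀ s ∈ C, M.gap ⟨s, π s⟩ ≤ 0) :
    π ∈ M.optimalPolicies := by
  intro s
  refine le_antisymm (M.gain_le_optimalGain π s) (le_gain_of_reaches hreach (fun y hy => ?_) s)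
  refine le_gain_of_isClosedUnder hC (h := M.optimalBias) (fun z hz => ?_) hy
  have h : M.optimalBias z + M.optimalGain z - M.meanReward ⟨z, π z⟩
    - ∑ s', (M.kernel ⟨z, π z⟩ s').toReal * M.optimalBias s' ≤ 0 := hgap z hz
  rw [hcomm.optimalGain_eq s z]
  linarith

/-- A nonempty set of states that is closed in `M'` under pairs which are neither suboptimal in `M'`
nor confusing would carry a policy that is gain optimal in both `M` and `M'`. -/
lemma eq_empty_of_isClosedUnder [∀ s, Nonempty (A s)] {M M' : MDP S A}
    (hcomm : M.IsCommunicating) (hdom : M'.Dominates M)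
    (hdisj : M'.optimalPolicies ∩ M.optimalPolicies = ∅) {π : Policy S A} {B : Set S}
    (hB : M'.IsClosedUnder π B)
    (hgood : ∀ s ∈ B, (⟨s, π s⟩ : Pair S A) ∉ M'.suboptimalPairs ∧
      (⟨s, π s⟩ : Pair S A) ∉ confusingPairs M M') : B = ∅ := by
  by_contra hne
  obtain ⟨C, hCB, hCne, hC, hrec⟩ :=
    hB.exists_recurrent (Set.nonempty_iff_ne_empty.2 hne)
  obtain ⟨π', hag, hreach⟩ := exists_policy_reaches hcomm hCne π
  have hC' := hC.congr hag
  have hopt' : π' ∈ M'.optimalPolicies := by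
    refine (hcomm.of_dominates hdom).mem_optimalPolicies hC' (fun s => ?_) fun s hs => ?_
    · obtain ⟨c, hc, h⟩ := hreach s
      exact ⟨c, hc, h.of_dominates hdom⟩
    · have := (hgood s (hCB hs)).1
      rw [hag s hs]
      exact not_lt.1 fun hlt => this (mem_suboptimalPairs.2 hlt)
  have hopt : π' ∈ M.optimalPolicies := by
    refine hcomm.mem_optimalPolicies (hC'.of_dominates hdom) hreach fun s hs => ?_
    have h := (hgood s (hCB hs)).2
    rw [hag s hs]
    exact not_lt.1 fun hlt =>
      h (mem_confusingPairs.2 ⟨⟨π', hopt', hrec π' hag s hs, hag s hs⟩, hlt⟩)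
  exact Set.eq_empty_iff_forall_notMem.1 hdisj π' ⟨hopt', hopt⟩

/-! ### A potential for the alternative model -/

omit [DecidableEq S] in
/-- If no nonempty set of states is closed under pairs of a set `G`, then states have levels such
that each pair in `G` leads with positive probability to a lower level. -/
lemma exists_level [∀ s, Nonempty (A s)] (M : MDP S A) (G : Set (Pair S A))
    (hG : ∀ (π : Policy S A) (B : Set S), M.IsClosedUnder π B →
      (∀ s ∈ B, (⟨s, π s⟩ : Pair S A) ∈ G) → B = ∅) :
    ∃ ℓ : S → ℕ, ∀ x ∈ G, ∃ s', M.kernel x s' ≠ 0 ∧ ℓ s' < ℓ x.1 := by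
  classical
  let next : Set S → Set S := fun W =>
    W ∪ {s | ∀ a, (⟨s, a⟩ : Pair S A) ∈ G → ∃ s', M.kernel ⟨s, a⟩ s' ≠ 0 ∧ s' ∈ W}
  let W : ℕ → Set S := fun n => Nat.rec (motive := fun _ => Set S) ∅ (fun _ W => next W) n
  have hsucc : ∀ n, W (n + 1) = next (W n) := fun n => rfl
  have hmono : Monotone W := monotone_nat_of_le_succ fun n => Set.subset_union_left
  obtain ⟨N, hN⟩ := WellFoundedGT.monotone_chain_condition (⟨W, hmono⟩ : ℕ →o Set S)
  have hfix : W (N + 1) = W N := (hN (N + 1) N.le_succ).symm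
  -- The states that never get a level form a closed set.
  have hout : ∀ s, s ∉ W N →
      ∃ a, (⟨s, a⟩ : Pair S A) ∈ G ∧ ∀ s', M.kernel ⟨s, a⟩ s' ≠ 0 → s' ∉ W N := by
    intro s hs
    rw [← hfix, hsucc] at hs
    by_contra! hcon
    exact hs (Or.inr hcon)
  choose act hactG hact using hout
  let π : Policy S A := fun (s : S) => if hs : s ∈ W N then Classical.arbitrary (A s) else act s hs
  have hπ : ∀ s (hs : s ∉ W N), π s = act s hs := fun s hs => dif_neg hs
  have hempty : (W N)ᶜ = ∅ := hG π (W N)ᶜ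
    (fun s hs s' hs' => hact s hs s' (hπ s hs ▸ hs')) fun s hs => (hπ s hs).symm ▸ hactG s hs
  have hex : ∀ s, ∃ n, s ∈ W n := fun s => ⟨N, by rw [Set.compl_empty_iff.1 hempty]; trivial⟩
  refine ⟨fun s => Nat.find (hex s), ?_⟩
  intro ⟨s, a⟩ hx
  have hmem := Nat.find_spec (hex s)
  obtain ⟨k, hk⟩ : ∃ k, Nat.find (hex s) = k + 1 := by
    refine Nat.exists_eq_succ_of_ne_zero fun h0 => ?_
    rw [h0] at hmem
    exact hmem
  rw [hk, hsucc] at hmem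
  obtain ⟨s', h1, h2⟩ :=
    hmem.resolve_left (Nat.find_min (hex s) (hk ▸ Nat.lt_succ_self k)) a hx
  exact ⟨s', h1, ((Nat.find_min' (hex s') h2).trans_lt (Nat.lt_succ_self k)).trans_eq hk.symm⟩

omit [DecidableEq S] in
/-- A potential that increases in expectation by at least `ε` at each pair of `G`: half
of `β ^ ℓ`, where `β` is half of the smallest positive transition probability. -/
lemma exists_potential {M : MDP S A} {G : Set (Pair S A)} {ℓ : S → ℕ}
    (hℓ : ∀ x ∈ G, ∃ s', M.kernel x s' ≠ 0 ∧ ℓ s' < ℓ x.1) :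
    ∃ φ : S → ℝ, (∀ s, φ s ∈ Set.Icc (0 : ℝ) 1) ∧ ∃ ε : ℝ, 0 < ε ∧
      (∀ x ∈ G, ε + φ x.1 ≤ ∑ s', (M.kernel x s').toReal * φ s') ∧
      ∀ x, ε + φ x.1 ≤ 1 + ∑ s', (M.kernel x s').toReal * φ s' := by
  obtain ⟨q, hq0, hq1, hq⟩ : ∃ q : ℝ, 0 < q ∧ q ≤ 1 ∧
      ∀ x s', M.kernel x s' ≠ 0 → q ≤ (M.kernel x s').toReal := by
    let F : Set (Pair S A × S) := {y | M.kernel y.1 y.2 ≠ 0}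
    have hpos : ∀ y ∈ F, 0 < (M.kernel y.1 y.2).toReal := fun y hy =>
      ENNReal.toReal_pos hy (PMF.apply_ne_top _ _)
    rcases F.eq_empty_or_nonempty with hF | hF
    · refine ⟨1, one_pos, le_rfl, fun x s' h => ?_⟩
      exact absurd (show (x, s') ∈ F from h) (hF ▸ Set.notMem_empty _)
    · obtain ⟨y, hy, hmin⟩ := Set.exists_min_image F (fun y => (M.kernel y.1 y.2).toReal)
        F.toFinite hF
      refine ⟨_, hpos y hy, ?_, fun x s' h => hmin (x, s') h⟩
      exact ENNReal.toReal_le_of_le_ofReal zero_le_one (by simpa using PMF.coe_le_one _ _)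
  obtain ⟨N, hN⟩ : ∃ N, ∀ s, ℓ s ≤ N :=
    ⟨∑ s, ℓ s, fun s => Finset.single_le_sum (fun _ _ => Nat.zero_le _) (Finset.mem_univ s)⟩
  set β : ℝ := q / 2 with hβ
  have hβ0 : 0 < β := by positivity
  have hβ1 : β ≤ 1 := by linarith
  have hpow : ∀ n : ℕ, 0 < β ^ n ∧ β ^ n ≤ 1 := fun n => ⟨pow_pos hβ0 n, pow_le_one₀ hβ0.le hβ1⟩
  have hnn : ∀ x s', 0 ≤ (M.kernel x s').toReal * (β ^ ℓ s' / 2) := fun x s' =>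
    mul_nonneg ENNReal.toReal_nonneg (half_pos (hpow _).1).le
  refine ⟨fun s => β ^ ℓ s / 2, fun s => ⟨by linarith [(hpow (ℓ s)).1], by
    linarith [(hpow (ℓ s)).2]⟩, β ^ N / 2, half_pos (hpow N).1, fun x hx => ?_, fun x => ?_⟩
  · obtain ⟨s', h1, h2⟩ := hℓ x hx
    calc β ^ N / 2 + β ^ ℓ x.1 / 2 ≤ β ^ ℓ x.1 / 2 + β ^ ℓ x.1 / 2 := by
          have := pow_le_pow_of_le_one hβ0.le hβ1 (hN x.1)
          linarith
      _ ≤ β ^ (ℓ s' + 1) := by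
          rw [add_halves]
          exact pow_le_pow_of_le_one hβ0.le hβ1 h2
      _ = q * (β ^ ℓ s' / 2) := by rw [pow_succ, hβ]; ring
      _ ≤ (M.kernel x s').toReal * (β ^ ℓ s' / 2) :=
          mul_le_mul_of_nonneg_right (hq x s' h1) (half_pos (hpow _).1).le
      _ ≤ _ := Finset.single_le_sum (f := fun s' => (M.kernel x s').toReal * (β ^ ℓ s' / 2))
          (fun s' _ => hnn x s') (Finset.mem_univ s')
  · have := Finset.sum_nonneg fun s' (_ : s' ∈ Finset.univ) => hnn x s'
    have h1 := (hpow N).2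
    have h2 := (hpow (ℓ x.1)).2
    simp only
    linarith

end MDP

/-! ### Concentration of the potential along the interaction -/

section Concentration

variable {S : Type*} {A : S → Type*} [Fintype S] [∀ s, Fintype (A s)]

omit [∀ s, Fintype (A s)] in
/-- The deviation of the potential of the next state from its conditional mean, `φ S_{t+1}` minus
the mean of `φ` under the kernel at the pair of time `t`. -/
noncomputable def potentialNoise (M : MDP S A) (φ : S → ℝ) (t : ℕ) (ω : ℕ → Obs S A) : ℝ :=
  φ (ω (t + 1)).1.1 - ∑ s', (M.kernel (ω t).1 s').toReal * φ s'

lemma measurable_comp_pair (f : Pair S A → ℝ) (t : ℕ) :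
    Measurable fun ω : ℕ → Obs S A => f (ω t).1 :=
  (measurable_of_countable f).comp (measurable_fst.comp (measurable_pi_apply t))

lemma measurable_potentialNoise (M : MDP S A) (φ : S → ℝ) (t : ℕ) :
    Measurable (potentialNoise M φ t) :=
  (measurable_comp_pair (fun x => φ x.1) (t + 1)).sub
    (measurable_comp_pair (fun x => ∑ s', (M.kernel x s').toReal * φ s') t)

lemma sum_pairLaw_mul (Λ : Learner S A) {n : ℕ} (q : PMF S) (h : Fin n → Obs S A) (φ : S → ℝ) :
    ∑ x : Pair S A, (pairLaw Λ q h x).toReal * φ x.1 = ∑ s, (q s).toReal * φ s := by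
  classical
  have happ : ∀ s a, pairLaw Λ q h ⟨s, a⟩ = q s * Λ.act n h s a := by
    intro s a
    refine (PMF.bind_apply _ _ _).trans ?_
    rw [tsum_eq_single s]
    · congr 1
      refine (PMF.map_apply _ _ _).trans ((tsum_eq_single a fun b hb => if_neg ?_).trans
        (if_pos rfl))
      intro hc
      exact hb (eq_of_heq (Sigma.mk.inj hc).2).symm
    · intro s' hs'
      refine mul_eq_zero_of_right _ ((PMF.map_apply _ _ _).trans
        (ENNReal.tsum_eq_zero.2 fun b => if_neg ?_))
      intro hc
      exact hs' (Sigma.mk.inj hc).1.symm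
  calc
    ∑ x : Pair S A, (pairLaw Λ q h x).toReal * φ x.1
      = ∑ s, ∑ a, (pairLaw Λ q h ⟨s, a⟩).toReal * φ s :=
        Fintype.sum_sigma (fun x : (Σ s, A s) => (pairLaw Λ q h x).toReal * φ x.1)
    _ = ∑ s, (q s).toReal * φ s := by
        refine Finset.sum_congr rfl fun s _ => ?_
        simp_rw [happ, ENNReal.toReal_mul]
        rw [← Finset.sum_mul, ← Finset.mul_sum, sum_toReal_pmf, mul_one]

lemma integral_stepKernel (M : MDP S A) (Λ : Learner S A) (n : ℕ)
    (h : (i : Finset.Iic n) → Obs S A) {φ : S → ℝ} (hφ : ∀ s, φ s ∈ Set.Icc (0 : ℝ) 1) :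
    ∫ y, φ y.1.1 ∂(stepKernel M Λ n h)
      = ∑ s', (M.kernel (toHistory h (Fin.last n)).1 s').toReal * φ s' := by
  have hm : Measurable fun y : Obs S A => φ y.1.1 :=
    (measurable_of_countable fun x : Pair S A => φ x.1).comp measurable_fst
  have hint : Integrable (fun y : Obs S A => φ y.1.1) (stepKernel M Λ n h) :=
    Integrable.of_mem_Icc 0 1 hm.aemeasurable (ae_of_all _ fun y => hφ y.1.1)
  rw [stepKernel] at hint ⊢
  rw [integral_compProd hint]
  simp only [integral_const, probReal_univ, one_smul]
  rw [show pairKernel M Λ n h = (nextPairLaw M Λ n h).toMeasure from rfl, PMF.integral_eq_sum]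
  exact sum_pairLaw_mul Λ _ _ φ

/-- Hoeffding's lemma for one step of the interaction. -/
lemma lintegral_exp_stepKernel_le (M : MDP S A) (Λ : Learner S A) (n : ℕ)
    (h : (i : Finset.Iic n) → Obs S A) {φ : S → ℝ} (hφ : ∀ s, φ s ∈ Set.Icc (0 : ℝ) 1) (l : ℝ) :
    ∫⁻ y, ENNReal.ofReal (Real.exp (l * (φ y.1.1
        - ∑ s', (M.kernel (toHistory h (Fin.last n)).1 s').toReal * φ s'))) ∂(stepKernel M Λ n h)
      ≤ ENNReal.ofReal (Real.exp (l ^ 2 / 8)) := by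
  have hm : Measurable fun y : Obs S A => φ y.1.1 :=
    (measurable_of_countable fun x : Pair S A => φ x.1).comp measurable_fst
  have hsub := hasSubgaussianMGF_of_mem_Icc (μ := stepKernel M Λ n h) hm.aemeasurable
    (ae_of_all _ fun y => hφ y.1.1)
  rw [integral_stepKernel M Λ n h hφ] at hsub
  rw [← ofReal_integral_eq_lintegral_ofReal (hsub.integrable_exp_mul l)
    (ae_of_all _ fun y => (Real.exp_pos _).le)]
  refine ENNReal.ofReal_le_ofReal ((hsub.mgf_le l).trans_eq ?_)
  congr 1
  simp
  ring

/-- Extension of a history to a trajectory by repetition of its last round. -/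
def extendHistory {n : ℕ} (h : (i : Finset.Iic n) → Obs S A) : ℕ → Obs S A :=
  fun t => h ⟨min t n, Finset.mem_Iic.2 (min_le_right _ _)⟩

omit [Fintype S] [∀ s, Fintype (A s)] in
lemma measurable_extendHistory {n : ℕ} :
    Measurable (extendHistory : ((i : Finset.Iic n) → Obs S A) → ℕ → Obs S A) :=
  measurable_pi_lambda _ fun _ => measurable_pi_apply _

omit [Fintype S] [∀ s, Fintype (A s)] in
lemma extendHistory_frestrictLe {n t : ℕ} (ht : t ≤ n) (ω : ℕ → Obs S A) :
    extendHistory (Preorder.frestrictLe (π := fun _ : ℕ => Obs S A) n ω) t = ω t := by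
  show ω (min t n) = ω t
  rw [min_eq_left ht]

lemma lintegral_exp_sum_potentialNoise_le (M : MDP S A) (Λ : Learner S A) (s₀ : S) {φ : S → ℝ}
    (hφ : ∀ s, φ s ∈ Set.Icc (0 : ℝ) 1) (l : ℝ) (n : ℕ) :
    ∫⁻ ω, ENNReal.ofReal (Real.exp (l * ∑ t ∈ Finset.range n, potentialNoise M φ t ω))
        ∂(interactionLaw M Λ s₀) ≤ ENNReal.ofReal (Real.exp (n * (l ^ 2 / 8))) := by
  induction n with
  | zero => simp
  | succ n ih =>
    let F : ((i : Finset.Iic n) → Obs S A) → ENNReal := fun h => ENNReal.ofReal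
      (Real.exp (l * ∑ t ∈ Finset.range n, potentialNoise M φ t (extendHistory h)))
    let H : ((i : Finset.Iic n) → Obs S A) × Obs S A → ENNReal := fun z => ENNReal.ofReal
      (Real.exp (l * (φ z.2.1.1
        - ∑ s', (M.kernel (toHistory z.1 (Fin.last n)).1 s').toReal * φ s')))
    have hF : Measurable F := by
      refine ENNReal.measurable_ofReal.comp (Real.measurable_exp.comp (Measurable.const_mul ?_ l))
      exact Finset.measurable_sum _ fun t _ =>
        (measurable_potentialNoise M φ t).comp measurable_extendHistory
    have hH : Measurable H := by
      refine ENNReal.measurable_ofReal.comp (Real.measurable_exp.comp (Measurable.const_mul ?_ l))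
      refine Measurable.sub ?_ ?_
      · exact (measurable_of_countable fun x : Pair S A => φ x.1).comp
          (measurable_fst.comp measurable_snd)
      · exact (measurable_of_countable fun x : Pair S A =>
          ∑ s', (M.kernel x s').toReal * φ s').comp (measurable_fst.comp
            ((measurable_pi_apply (Fin.last n)).comp (measurable_toHistory.comp measurable_fst)))
    have hFω : ∀ ω : ℕ → Obs S A, F (Preorder.frestrictLe n ω) = ENNReal.ofReal
        (Real.exp (l * ∑ t ∈ Finset.range n, potentialNoise M φ t ω)) := by
      intro ω
      simp only [F]
      congr 3
      refine Finset.sum_congr rfl fun t ht => ?_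
      have ht := Finset.mem_range.1 ht
      rw [potentialNoise, potentialNoise, extendHistory_frestrictLe ht,
        extendHistory_frestrictLe ht.le]
    have hFH : Measurable fun z : ((i : Finset.Iic n) → Obs S A) × Obs S A => F z.1 * H z :=
      (hF.comp measurable_fst).mul hH
    have hrest : Measurable (Preorder.frestrictLe (π := fun _ : ℕ => Obs S A) n) := by fun_prop
    calc ∫⁻ ω, ENNReal.ofReal
          (Real.exp (l * ∑ t ∈ Finset.range (n + 1), potentialNoise M φ t ω))
            ∂(interactionLaw M Λ s₀)
        = ∫⁻ ω, F (Preorder.frestrictLe n ω) * H (Preorder.frestrictLe n ω, ω (n + 1))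
            ∂(interactionLaw M Λ s₀) := by
          refine lintegral_congr fun ω => ?_
          rw [hFω, Finset.sum_range_succ, mul_add, Real.exp_add,
            ENNReal.ofReal_mul (Real.exp_pos _).le]
          rfl
      _ = ∫⁻ z, F z.1 * H z ∂((interactionLaw M Λ s₀).map
            fun ω => (Preorder.frestrictLe n ω, ω (n + 1))) := by
          rw [lintegral_map hFH (hrest.prodMk (measurable_pi_apply _))]
      _ = ∫⁻ z, F z.1 * H z ∂(((interactionLaw M Λ s₀).map
            (Preorder.frestrictLe n)) ⊗ₘ stepKernel M Λ n) := by
          rw [interactionLaw, Kernel.map_frestrictLe_trajMeasure_compProd_eq_map_trajMeasure]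
      _ = ∫⁻ h, F h * ∫⁻ y, H (h, y) ∂(stepKernel M Λ n h)
            ∂((interactionLaw M Λ s₀).map (Preorder.frestrictLe n)) := by
          rw [Measure.lintegral_compProd hFH]
          refine lintegral_congr fun h => ?_
          have hHh : Measurable fun y : Obs S A => H (h, y) := hH.comp measurable_prodMk_left
          exact lintegral_const_mul (F h) hHh
      _ ≤ ∫⁻ h, F h * ENNReal.ofReal (Real.exp (l ^ 2 / 8))
            ∂((interactionLaw M Λ s₀).map (Preorder.frestrictLe n)) :=
          lintegral_mono fun h =>
            mul_le_mul_right (lintegral_exp_stepKernel_le M Λ n h hφ l) _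
      _ = (∫⁻ ω, F (Preorder.frestrictLe n ω) ∂(interactionLaw M Λ s₀))
            * ENNReal.ofReal (Real.exp (l ^ 2 / 8)) := by
          rw [lintegral_mul_const _ hF, lintegral_map hF hrest]
      _ ≤ ENNReal.ofReal (Real.exp (n * (l ^ 2 / 8))) * ENNReal.ofReal (Real.exp (l ^ 2 / 8)) := by
          refine mul_le_mul_left ?_ _
          simp_rw [hFω]
          exact ih
      _ = ENNReal.ofReal (Real.exp ((n + 1 : ℕ) * (l ^ 2 / 8))) := by
          rw [← ENNReal.ofReal_mul (Real.exp_pos _).le, ← Real.exp_add]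
          congr 2
          push_cast
          ring

/-- The Azuma-Hoeffding inequality for the noise of a potential with values in `[0, 1]`. -/
lemma measure_sum_potentialNoise_le (M : MDP S A) (Λ : Learner S A) (s₀ : S) {φ : S → ℝ}
    (hφ : ∀ s, φ s ∈ Set.Icc (0 : ℝ) 1) {T : ℕ} (hT : 0 < T) {u : ℝ} (hu : 0 ≤ u) :
    (interactionLaw M Λ s₀).real {ω | ∑ t ∈ Finset.range T, potentialNoise M φ t ω ≤ -u}
      ≤ Real.exp (-(2 * u ^ 2) / T) := by
  have hT' : (0 : ℝ) < T := Nat.cast_pos.2 hT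
  -- The value that minimizes `-l u + T l² / 8`, applied to the negated noise.
  set l : ℝ := 4 * u / T with hl
  have hl0 : 0 ≤ l := by positivity
  set f : (ℕ → Obs S A) → ENNReal := fun ω => ENNReal.ofReal
    (Real.exp (-l * ∑ t ∈ Finset.range T, potentialNoise M φ t ω))
  have hf : Measurable f :=
    ENNReal.measurable_ofReal.comp (Real.measurable_exp.comp (Measurable.const_mul
      (Finset.measurable_sum _ fun t _ => measurable_potentialNoise M φ t) _))
  have hsub : {ω | ∑ t ∈ Finset.range T, potentialNoise M φ t ω ≤ -u}
      ⊆ {ω | ENNReal.ofReal (Real.exp (l * u)) ≤ f ω} := by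
    intro ω hω
    refine ENNReal.ofReal_le_ofReal (Real.exp_le_exp.2 ?_)
    have := mul_le_mul_of_nonneg_left (show _ ≤ -u from hω) hl0
    linarith
  have hmarkov := (mul_meas_ge_le_lintegral (μ := interactionLaw M Λ s₀) hf
    (ENNReal.ofReal (Real.exp (l * u)))).trans
      (lintegral_exp_sum_potentialNoise_le M Λ s₀ hφ (-l) T)
  have hreal := ENNReal.toReal_mono ENNReal.ofReal_ne_top hmarkov
  rw [ENNReal.toReal_mul, ENNReal.toReal_ofReal (Real.exp_pos _).le,
    ENNReal.toReal_ofReal (Real.exp_pos _).le, ← le_div_iff₀' (Real.exp_pos _),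
    ← Real.exp_sub] at hreal
  refine (measureReal_mono hsub).trans (hreal.trans_eq ?_)
  congr 1
  rw [hl]
  field_simp
  ring

omit [Fintype S] [∀ s, Fintype (A s)] in
lemma sum_visits [DecidableEq S] [∀ s, DecidableEq (A s)] (F : Finset (Pair S A)) (T : ℕ)
    (ω : ℕ → Obs S A) :
    ∑ x ∈ F, (visits T x ω : ℝ)
      = ∑ t ∈ Finset.range T, if (ω t).1 ∈ F then (1 : ℝ) else 0 := by
  simp only [visits, Finset.card_filter, Nat.cast_sum, Nat.cast_ite, Nat.cast_one, Nat.cast_zero]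
  rw [Finset.sum_comm]
  simp

omit [∀ s, Fintype (A s)] in
/-- Telescoping of the potential along a trajectory. -/
lemma mul_add_sum_potentialNoise_le {M : MDP S A} {φ : S → ℝ}
    (hφ : ∀ s, φ s ∈ Set.Icc (0 : ℝ) 1) {ε : ℝ} {c : Pair S A → ℝ}
    (hc : ∀ x, ε + φ x.1 ≤ c x + ∑ s', (M.kernel x s').toReal * φ s') (T : ℕ)
    (ω : ℕ → Obs S A) :
    ε * T + ∑ t ∈ Finset.range T, potentialNoise M φ t ω - 1
      ≤ ∑ t ∈ Finset.range T, c (ω t).1 := by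
  have key : ε * T + ∑ t ∈ Finset.range T, potentialNoise M φ t ω
      + (φ (ω 0).1.1 - φ (ω T).1.1) ≤ ∑ t ∈ Finset.range T, c (ω t).1 := by
    induction T with
    | zero => simp
    | succ T ih =>
      rw [Finset.sum_range_succ, Finset.sum_range_succ]
      have := hc (ω T).1
      simp only [potentialNoise] at ih ⊢
      push_cast
      linarith
  have h0 := (hφ (ω 0).1.1).1
  have h1 := (hφ (ω T).1.1).2
  linarith

end Concentration

end RegretMDP

theorem mainTheorem10 {S : Type*} {A : S → Type*} [Fintype S] [DecidableEq S]
    [∀ s, Fintype (A s)] [∀ s, DecidableEq (A s)] [∀ s, Nonempty (A s)]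
    (models : Set (RegretMDP.MDP S A)) (M : RegretMDP.MDP S A) (hM : M ∈ models)
    (hcomm : M.IsCommunicating)
    (M' : RegretMDP.MDP S A) (hM' : M' ∈ RegretMDP.MDP.alternative models M) :
    ∃ ε : ℝ, 0 < ε ∧ ∃ D : ℝ, 0 < D ∧ ∃ T₀ : ℕ,
      ∀ (Λ : RegretMDP.Learner S A) (s₀ : S) (T : ℕ), T₀ ≤ T → ∀ u : ℝ, 0 ≤ u →
        (RegretMDP.interactionLaw M' Λ s₀).real
            {ω | ∑ x ∈ RegretMDP.MDP.confusingPairs M M', (RegretMDP.visits T x ω : ℝ)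
                + D * ∑ x ∈ M'.suboptimalPairs, (RegretMDP.visits T x ω : ℝ)
              ≤ ε * (T : ℝ) - u}
          ≤ Real.exp (-(2 * u ^ 2) / ((T : ℝ) * D ^ 2)) := by
  classical
  obtain ⟨-, hdom, hdisj⟩ := hM'
  obtain ⟨ℓ, hℓ⟩ := M'.exists_level
    {x | x ∉ M'.suboptimalPairs ∧ x ∉ RegretMDP.MDP.confusingPairs M M'}
    fun π B hB hgood => RegretMDP.MDP.eq_empty_of_isClosedUnder hcomm hdom hdisj hB hgood
  obtain ⟨φ, hφ, ε, hε, hgood, hall⟩ := RegretMDP.MDP.exists_potential hℓ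
  -- Half of the drift `ε T` absorbs the telescoping remainder, which is at most `1`.
  refine ⟨ε / 2, half_pos hε, 1, one_pos, ⌈2 / ε⌉₊, fun Λ s₀ T hT u hu => ?_⟩
  have hT2 : 2 / ε ≤ T := (Nat.le_ceil _).trans (Nat.cast_le.2 hT)
  have hTpos : 0 < T := Nat.cast_pos.1 ((div_pos two_pos hε).trans_le hT2)
  rw [div_le_iff₀ hε] at hT2
  rw [one_pow, mul_one]
  refine le_trans (measureReal_mono fun ω hω => ?_)
    (RegretMDP.measure_sum_potentialNoise_le M' Λ s₀ hφ hTpos hu)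
  have hdrift := RegretMDP.mul_add_sum_potentialNoise_le (M := M') hφ (ε := ε)
    (c := fun x => (if x ∈ RegretMDP.MDP.confusingPairs M M' then 1 else 0)
      + if x ∈ M'.suboptimalPairs then 1 else 0) (fun x => ?_) T ω
  · rw [Set.mem_ofPred_eq, RegretMDP.sum_visits, RegretMDP.sum_visits, one_mul,
      ← Finset.sum_add_distrib] at hω
    rw [Set.mem_ofPred_eq]
    linarith
  · have h1 := hall x
    by_cases hx1 : x ∈ RegretMDP.MDP.confusingPairs M M' <;>
      by_cases hx2 : x ∈ M'.suboptimalPairs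
    · simp only [hx1, hx2, if_true]; linarith
    · simp only [hx1, hx2, if_true, if_false]; linarith
    · simp only [hx1, hx2, if_true, if_false]; linarith
    · have h2 := hgood x ⟨hx2, hx1⟩
      simp only [hx1, hx2, if_false]; linarith
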